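/- Let $(\Omega,\Sigma,\lambda)$ be a finite measure space. For each $\omega\in\Omega$ let $\nabla_\omega$ be a complete Boolean algebra with a strictly positive (finite, countably additive) real-valued measure $\mu_\omega$, regarded as a metric space with $\rho_\omega(e,g)=\mu_\omega(e\vartriangle g)$. A section is a function $e$ defined $\lambda$-almost everywhere with $e(\omega)\in\nabla_\omega$. Let $(\nabla,L)$ be a measurable bundle of Boolean algebras over $\Omega$: $L$ is a nonempty set of sections, closed under the pointwise operations $e\mapsto e^\perp$ and $(e,g)\mapsto e\vee g$, such that $\omega\mapsto\rho_\omega(e(\omega),g(\omega))$ is measurable for all $e,g\in L$ and $\{e(\omega): e\in L,\ \omega\in\mathrm{dom}(e)\}$ is dense in $\nabla_\omega$ for every $\omega$. A step-section is a section that equals $u_i$ on $A_i$ ($1\le i\le k$) and $0$ elsewhere, for finitely many pairwise disjoint $A_i\in\Sigma$ and $u_i\in L$; a measurable section is a $\lambda$-a.e. limit, in the metrics $\rho_\omega$, of a sequence of step-sections. Let $\hat\nabla$ be the Boolean algebra of measurable sections modulo equality a.e., with the strictly positive $L_0(\Omega)$-valued measure $\hat\mu$ given by $\hat\mu(\hat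 e)(\omega)=\mu_\omega(e(\omega))$. For a complete Boolean algebra $B$ with a strictly positive measure, $L_0(B)=C_\infty(Q(B))$ is the lattice of continuous functions from the Stone compact $Q(B)$ to $[-\infty,\infty]$ that are finite on a dense set, with the pointwise order. For $f\in L_0(B)$ and $\alpha\in\mathbb R$ let $[f>\alpha]\in B$ be the element whose clopen set is the closure of $\{x\in Q(B): f(x)>\alpha\}$. An element $\hat f\in L_0(\hat\nabla,\hat\mu)$ is identified with a section $\omega\mapsto f(\omega)\in L_0(\nabla_\omega,\mu_\omega)$ such that, for every $\alpha\in\mathbb R$, $[\hat f>\alpha]$ is the class of a measurable section whose value at a.e. $\omega$ is $[f(\omega)>\alpha]$; we write $\hat f(\omega)=f(\omega)$. Then every $\hat f\in L_0(\hat\nabla,\hat\mu)$ is identified in this way with a section $\omega\mapsto f(\omega)$, which is unique up to equality a.e., and the following holds. Let $d\in\mathbb N$, let $\hat f_{\mathbf n}\in L_0(\hat\nabla,\hat\mu)$ for $\mathbf n\in\mathbb N^d$, and let $\omega\mapsto f_{\mathbf n}(\omega)$ be the corresponding sections. Then $\sup_{\mathbf n}\hat f_{\mathbf n}$ exists in $L_0(\hat\nabla,\hat\mu)$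 if and only if $\sup_{\mathbf n}f_{\mathbf n}(\omega)$ exists in $L_0(\nabla_\omega,\mu_\omega)$ for a.e. $\omega\in\Omega$. In that case $$\Bigl(\sup_{\mathbf n}\hat f_{\mathbf n}\Bigr)(\omega)=\sup_{\mathbf n}f_{\mathbf n}(\omega)\quad\text{for a.e. }\omega\in\Omega.$$ -/

import Mathlib

open MeasureTheory Filter Topology
open scoped symmDiff

universe u v

/-! ### The Stone compact of a Boolean algebra and the lattice `C_∞(Q(B))` -/

/-- The Stone compact `Q(B)` of a Boolean algebra `B`: its points are the Boolean homomorphisms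
from `B` to the two-element algebra (equivalently, the ultrafilters of `B`). -/
abbrev StoneCompact (B : Type v) [BooleanAlgebra B] : Type v := BoundedLatticeHom B Bool

namespace StoneCompact

variable {B : Type v} [BooleanAlgebra B]

/-- The topology of pointwise convergence; the sets `clopen b` form a base of it. -/
noncomputable instance : TopologicalSpace (StoneCompact B) :=
  TopologicalSpace.induced (fun (x : StoneCompact B) (b : B) => x b) inferInstance

/-- The clopen subset of the Stone compact that corresponds to `b`. -/
def clopen (b : B) : Set (StoneCompact B) := {x | x b = true}

end StoneCompact

/-- `C_∞(Q(B))`: the continuous functions from the Stone compact of `B` to `[-∞, ∞]` that are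
finite on a dense set. For a complete Boolean algebra `B` with a strictly positive measure `m`
this is `L₀(B, m)`. -/
structure LZero (B : Type v) [BooleanAlgebra B] where
  toFun : StoneCompact B → EReal
  continuous_toFun : Continuous toFun
  dense_finite : Dense {x | toFun x ≠ ⊥ ∧ toFun x ≠ ⊤}

namespace LZero

variable {B : Type v} [BooleanAlgebra B]

@[ext] theorem ext {f g : LZero B} (h : ∀ x, f.toFun x = g.toFun x) : f = g := by
  cases f; cases g; congr; exact funext h

/-- The pointwise order. -/
instance : PartialOrder (LZero B) where
  le f g := ∀ x, f.toFun x ≤ g.toFun x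
  le_refl _ _ := le_rfl
  le_trans _ _ _ h h' x := (h x).trans (h' x)
  le_antisymm _ _ h h' := LZero.ext fun x => le_antisymm (h x) (h' x)

/-- `f.IsLevel α b` says that `b` is the element `[f > α]` of the Boolean algebra, i.e. that the
clopen set of `b` is the closure of `{x | f x > α}`. (In the Stone compact of a complete Boolean
algebra the closure of an open set is clopen.) -/
def IsLevel (f : LZero B) (α : ℝ) (b : B) : Prop :=
  StoneCompact.clopen b = closure {x | (α : EReal) < f.toFun x}

end LZero

/-- A strictly positive (finite, countably additive) real-valued measure on a Boolean algebra. -/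
structure StrictMeasure (B : Type v) [BooleanAlgebra B] where
  val : B → ℝ
  nonneg : ∀ e, 0 ≤ val e
  additive : ∀ e g, e ⊓ g = ⊥ → val (e ⊔ g) = val e + val g
  continuous : ∀ e : ℕ → B, Antitone e → IsGLB (Set.range e) ⊥ →
    Tendsto (fun n => val (e n)) atTop (𝓝 0)
  eq_bot : ∀ e, val e = 0 → e = ⊥

namespace StrictMeasure

variable {B : Type v} [BooleanAlgebra B] (m : StrictMeasure B)

/-- The metric `ρ(e, g) = m(e ∆ g)`. -/
def dist (e g : B) : ℝ := m.val (e ∆ g)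

theorem mono {e g : B} (h : e ≤ g) : m.val e ≤ m.val g := by
  have h1 := m.additive e (g \ e) (inf_sdiff_self_right)
  rw [sup_sdiff_cancel_right h] at h1
  linarith [m.nonneg (g \ e)]

theorem dist_nonneg (e g : B) : 0 ≤ m.dist e g := m.nonneg _

theorem dist_self (e : B) : m.dist e e = 0 := by
  have := m.additive (⊥ : B) ⊥ (by simp)
  simp only [le_refl, sup_of_le_left] at this
  simp only [dist, symmDiff_self]
  linarith

theorem val_sup_le (e g : B) : m.val (e ⊔ g) ≤ m.val e + m.val g := by
  have h1 := m.additive e (g \ e) (inf_sdiff_self_right)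
  rw [sup_sdiff_self_right] at h1
  linarith [m.mono (sdiff_le : g \ e ≤ g)]

theorem dist_compl (e g : B) : m.dist eᶜ gᶜ = m.dist e g := by
  simp only [dist, compl_symmDiff_compl]

theorem dist_sup_le (e e' g g' : B) :
    m.dist (e ⊔ e') (g ⊔ g') ≤ m.dist e g + m.dist e' g' := by
  refine (m.mono ?_).trans (m.val_sup_le _ _)
  simp only [symmDiff_def, sup_sdiff]
  refine sup_le (sup_le ?_ ?_) (sup_le ?_ ?_)
  · exact (sdiff_le_sdiff_left le_sup_left).trans (le_sup_left.trans le_sup_left)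
  · exact (sdiff_le_sdiff_left le_sup_right).trans (le_sup_left.trans le_sup_right)
  · exact (sdiff_le_sdiff_left le_sup_left).trans (le_sup_right.trans le_sup_left)
  · exact (sdiff_le_sdiff_left le_sup_right).trans (le_sup_right.trans le_sup_right)

end StrictMeasure

/-! ### Sections and measurable bundles of Boolean algebras -/

/-- A section: a function `ω ↦ u(ω) ∈ ∇_ω` defined on a set `dom` of full measure. -/
structure BSection {Ω : Type u} [MeasurableSpace Ω] (lam : Measure Ω) (nab : Ω → Type v) where
  dom : Set Ω
  ae_dom : ∀ᵐ ω ∂lam, ω ∈ dom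
  val : ∀ ω, ω ∈ dom → nab ω

namespace BSection

variable {Ω : Type u} [MeasurableSpace Ω] {lam : Measure Ω} {nab : Ω → Type v}
  [∀ ω, CompleteBooleanAlgebra (nab ω)]

/-- The complement `e^⊥`, on `dom e`. -/
def compl (e : BSection lam nab) : BSection lam nab where
  dom := e.dom
  ae_dom := e.ae_dom
  val ω h := (e.val ω h)ᶜ

/-- The join `e ∨ g`, on `dom e ∩ dom g`. -/
def sup (e g : BSection lam nab) : BSection lam nab where
  dom := e.dom ∩ g.dom
  ae_dom := e.ae_dom.and g.ae_dom
  val ω h := e.val ω h.1 ⊔ g.val ω h.2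

end BSection

/-- A measurable bundle of Boolean algebras over `(Ω, Σ, lam)` with fibres `(∇_ω, μ_ω)`: a nonempty
set `L` of sections such that `(∇, L)` is a measurable bundle of metric spaces
(fields `measurable_dist` and `dense`) and `L` is closed under complements and joins. -/
structure BooleanBundle {Ω : Type u} [MeasurableSpace Ω] (lam : Measure Ω) (nab : Ω → Type v)
    [∀ ω, CompleteBooleanAlgebra (nab ω)] where
  μ : ∀ ω, StrictMeasure (nab ω)
  L : Set (BSection lam nab)
  nonempty : L.Nonempty
  /-- The (almost everywhere defined) function `ω ↦ ρ_ω(e(ω), g(ω))` is measurable. -/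
  measurable_dist : ∀ e ∈ L, ∀ g ∈ L, ∃ r : Ω → ℝ, Measurable r ∧
    ∀ᵐ ω ∂lam, ∀ (he : ω ∈ e.dom) (hg : ω ∈ g.dom),
      r ω = (μ ω).dist (e.val ω he) (g.val ω hg)
  /-- `{e(ω) : e ∈ L, ω ∈ dom e}` is dense in the metric space `∇_ω`, for every `ω`. -/
  dense : ∀ (ω : Ω) (a : nab ω) (ε : ℝ), 0 < ε →
    ∃ e ∈ L, ∃ he : ω ∈ e.dom, (μ ω).dist (e.val ω he) a < ε
  compl_mem : ∀ e ∈ L, e.compl ∈ L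
  sup_mem : ∀ e ∈ L, ∀ g ∈ L, e.sup g ∈ L

namespace BooleanBundle

variable {Ω : Type u} [MeasurableSpace Ω] {lam : Measure Ω} {nab : Ω → Type v}
  [∀ ω, CompleteBooleanAlgebra (nab ω)] (X : BooleanBundle lam nab)

/-- Step-sections `s(ω) = ∑ χ_{A_i}(ω) u_i(ω)` with finitely many pairwise disjoint measurable sets
`A_i` and sections `u_i ∈ L`. Here and below sections that matter only up to equality almost
everywhere are represented by everywhere defined functions. -/
def IsStep (s : ∀ ω, nab ω) : Prop :=
  ∃ (ι : Type) (_ : Finite ι) (A : ι → Set Ω) (e : ι → BSection lam nab),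
    (∀ i, MeasurableSet (A i)) ∧ Pairwise (fun i j => Disjoint (A i) (A j)) ∧
    (∀ i, e i ∈ X.L) ∧
    ∀ᵐ ω ∂lam, (∀ i, ω ∈ A i → ∀ h : ω ∈ (e i).dom, s ω = (e i).val ω h) ∧
      ((∀ i, ω ∉ A i) → s ω = ⊥)

/-- Measurable sections: limits almost everywhere, in the metrics `ρ_ω`, of sequences of
step-sections. -/
def IsMeasurableSection (e : ∀ ω, nab ω) : Prop :=
  ∃ s : ℕ → ∀ ω, nab ω, (∀ n, X.IsStep (s n)) ∧
    ∀ᵐ ω ∂lam, Tendsto (fun n => (X.μ ω).dist (s n ω) (e ω)) atTop (𝓝 0)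

theorem exists_bot_section :
    ∃ z ∈ X.L, ∀ ω (h : ω ∈ z.dom), z.val ω h = ⊥ := by
  obtain ⟨e, he⟩ := X.nonempty
  refine ⟨(e.sup e.compl).compl, X.compl_mem _ (X.sup_mem _ he _ (X.compl_mem _ he)), ?_⟩
  intro ω h
  simp [BSection.compl, BSection.sup]

variable {X}

/-- A step-section may be written over a partition that covers the base. -/
theorem IsStep.exists_cover {s : ∀ ω, nab ω} (hs : X.IsStep s) :
    ∃ (ι : Type) (_ : Finite ι) (A : ι → Set Ω) (e : ι → BSection lam nab),
      (∀ i, MeasurableSet (A i)) ∧ Pairwise (fun i j => Disjoint (A i) (A j)) ∧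
      (∀ i, e i ∈ X.L) ∧ (∀ ω, ∃ i, ω ∈ A i) ∧
      ∀ᵐ ω ∂lam, ∀ i, ω ∈ A i → ∀ h : ω ∈ (e i).dom, s ω = (e i).val ω h := by
  obtain ⟨ι, hι, A, e, hA, hd, he, hs⟩ := hs
  obtain ⟨z, hz, hz0⟩ := X.exists_bot_section
  refine ⟨Option ι, inferInstance, fun i => i.elim (⋃ j, A j)ᶜ A, fun i => i.elim z e, ?_, ?_,
    ?_, ?_, ?_⟩
  · rintro (_ | i)
    · exact (MeasurableSet.iUnion hA).compl
    · exact hA i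
  · rintro (_ | i) (_ | j) hij
    · exact absurd rfl hij
    · exact (Set.disjoint_compl_left_iff_subset.2 (Set.subset_iUnion A j))
    · exact (Set.disjoint_compl_right_iff_subset.2 (Set.subset_iUnion A i))
    · exact hd (fun h => hij (h ▸ rfl))
  · rintro (_ | i)
    · exact hz
    · exact he i
  · intro ω
    by_cases h : ∃ i, ω ∈ A i
    · exact ⟨some h.choose, h.choose_spec⟩
    · exact ⟨none, by simpa using h⟩
  · filter_upwards [hs] with ω hω
    rintro (_ | i) hi h
    · have h0 : ∀ i, ω ∉ A i := by simpa using hi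
      exact (hω.2 h0).trans (hz0 ω h).symm
    · exact hω.1 i hi h

theorem IsStep.compl {s : ∀ ω, nab ω} (hs : X.IsStep s) : X.IsStep sᶜ := by
  obtain ⟨ι, hι, A, e, hA, hd, he, hc, hs⟩ := hs.exists_cover
  refine ⟨ι, hι, A, fun i => (e i).compl, hA, hd, fun i => X.compl_mem _ (he i), ?_⟩
  filter_upwards [hs] with ω hω
  refine ⟨fun i hi h => ?_, fun h => absurd (hc ω) (by simpa using h)⟩
  rw [Pi.compl_apply, hω i hi h]
  rfl

theorem IsStep.sup {s t : ∀ ω, nab ω} (hs : X.IsStep s) (ht : X.IsStep t) :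
    X.IsStep (s ⊔ t) := by
  obtain ⟨ι, hι, A, e, hA, hd, he, hc, hs⟩ := hs.exists_cover
  obtain ⟨κ, hκ, A', e', hA', hd', he', hc', ht⟩ := ht.exists_cover
  refine ⟨ι × κ, inferInstance, fun p => A p.1 ∩ A' p.2, fun p => (e p.1).sup (e' p.2),
    fun p => (hA _).inter (hA' _), ?_, fun p => X.sup_mem _ (he _) _ (he' _), ?_⟩
  · rintro ⟨i, j⟩ ⟨i', j'⟩ hij
    by_cases h : i = i'
    · subst h
      have : j ≠ j' := fun h => hij (h ▸ rfl)
      exact (hd' this).mono Set.inter_subset_right Set.inter_subset_right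
    · exact (hd h).mono Set.inter_subset_left Set.inter_subset_left
  · filter_upwards [hs, ht] with ω h1 h2
    refine ⟨fun p hp h => ?_, fun h => ?_⟩
    · rw [Pi.sup_apply, h1 p.1 hp.1 h.1, h2 p.2 hp.2 h.2]
      rfl
    · obtain ⟨i, hi⟩ := hc ω
      obtain ⟨j, hj⟩ := hc' ω
      exact absurd ⟨hi, hj⟩ (h (i, j))

theorem IsStep.bot : X.IsStep (⊥ : ∀ ω, nab ω) :=
  ⟨Empty, inferInstance, fun i => i.elim, fun i => i.elim, fun i => i.elim, fun i => i.elim,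
    fun i => i.elim, Eventually.of_forall fun _ => ⟨fun i => i.elim, fun _ => rfl⟩⟩

theorem IsMeasurableSection.compl {e : ∀ ω, nab ω} (he : X.IsMeasurableSection e) :
    X.IsMeasurableSection eᶜ := by
  obtain ⟨s, hs, h⟩ := he
  refine ⟨fun n => (s n)ᶜ, fun n => (hs n).compl, ?_⟩
  filter_upwards [h] with ω hω
  simpa only [Pi.compl_apply, StrictMeasure.dist_compl] using hω

theorem IsMeasurableSection.sup {e g : ∀ ω, nab ω} (he : X.IsMeasurableSection e)
    (hg : X.IsMeasurableSection g) : X.IsMeasurableSection (e ⊔ g) := by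
  obtain ⟨s, hs, h⟩ := he
  obtain ⟨t, ht, h'⟩ := hg
  refine ⟨fun n => s n ⊔ t n, fun n => (hs n).sup (ht n), ?_⟩
  filter_upwards [h, h'] with ω hω hω'
  exact squeeze_zero (fun n => StrictMeasure.dist_nonneg _ _ _)
    (fun n => StrictMeasure.dist_sup_le _ _ _ _ _) (by simpa using hω.add hω')

theorem IsMeasurableSection.bot : X.IsMeasurableSection (⊥ : ∀ ω, nab ω) :=
  ⟨fun _ => ⊥, fun _ => IsStep.bot, Eventually.of_forall fun ω => by
    simp [StrictMeasure.dist_self]⟩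

variable (X)

/-- `M(Ω, ∇)`: the measurable sections, with the fibrewise operations. -/
def M : BooleanSubalgebra (∀ ω, nab ω) where
  carrier := {e | X.IsMeasurableSection e}
  supClosed' _ he _ hg := he.sup hg
  infClosed' e he g hg := by
    have := (he.compl.sup hg.compl).compl
    rwa [compl_sup, compl_compl, compl_compl] at this
  compl_mem' he := he.compl
  bot_mem' := IsMeasurableSection.bot

/-- Equality almost everywhere of measurable sections. -/
def aeSetoid : Setoid X.M where
  r e g := ∀ᵐ ω ∂lam, e.1 ω = g.1 ω
  iseqv :=
    { refl := fun _ => Eventually.of_forall fun _ => rfl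
      symm := fun h => h.mono fun _ h => h.symm
      trans := fun h h' => by filter_upwards [h, h'] with ω a b using a.trans b }

/-- The Boolean algebra of classes of measurable sections modulo equality almost everywhere. -/
def Hat : Type (max u v) := Quotient X.aeSetoid

/-- The class of a measurable section. -/
def hat (e : X.M) : X.Hat := Quotient.mk X.aeSetoid e

/-- The operations are the fibrewise ones, and `hat e ≤ hat g` means `e(ω) ≤ g(ω)` for almost
every `ω`. -/
instance : BooleanAlgebra X.Hat where
  le := Quotient.lift₂ (fun e g : X.M => ∀ᵐ ω ∂lam, e.1 ω ≤ g.1 ω) (by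
    intro a b a' b' h h'
    refine propext ⟨fun H => ?_, fun H => ?_⟩
    · filter_upwards [h, h', H] with ω h1 h2 h3
      rwa [← h1, ← h2]
    · filter_upwards [h, h', H] with ω h1 h2 h3
      rwa [h1, h2])
  le_refl := by
    rintro ⟨a⟩
    exact Eventually.of_forall fun _ => le_rfl
  le_trans := by
    rintro ⟨a⟩ ⟨b⟩ ⟨c⟩ h h'
    change ∀ᵐ ω ∂lam, a.1 ω ≤ b.1 ω at h
    change ∀ᵐ ω ∂lam, b.1 ω ≤ c.1 ω at h'
    change ∀ᵐ ω ∂lam, a.1 ω ≤ c.1 ω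
    filter_upwards [h, h'] with ω h1 h2 using h1.trans h2
  le_antisymm := by
    rintro ⟨a⟩ ⟨b⟩ h h'
    change ∀ᵐ ω ∂lam, a.1 ω ≤ b.1 ω at h
    change ∀ᵐ ω ∂lam, b.1 ω ≤ a.1 ω at h'
    refine Quotient.sound (s := X.aeSetoid) (?_ : ∀ᵐ ω ∂lam, a.1 ω = b.1 ω)
    filter_upwards [h, h'] with ω h1 h2 using h1.antisymm h2
  sup := Quotient.map₂ (· ⊔ ·) (by
    intro a a' h b b' h'
    change ∀ᵐ ω ∂lam, a.1 ω ⊔ b.1 ω = a'.1 ω ⊔ b'.1 ω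
    filter_upwards [h, h'] with ω h1 h2
    rw [h1, h2])
  inf := Quotient.map₂ (· ⊓ ·) (by
    intro a a' h b b' h'
    change ∀ᵐ ω ∂lam, a.1 ω ⊓ b.1 ω = a'.1 ω ⊓ b'.1 ω
    filter_upwards [h, h'] with ω h1 h2
    rw [h1, h2])
  compl := Quotient.map (·ᶜ) (by
    intro a a' h
    change ∀ᵐ ω ∂lam, (a.1 ω)ᶜ = (a'.1 ω)ᶜ
    filter_upwards [h] with ω h1
    rw [h1])
  top := X.hat ⊤
  bot := X.hat ⊥
  le_sup_left := by
    rintro ⟨a⟩ ⟨b⟩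
    exact Eventually.of_forall fun ω => (le_sup_left : a.1 ω ≤ a.1 ω ⊔ b.1 ω)
  le_sup_right := by
    rintro ⟨a⟩ ⟨b⟩
    exact Eventually.of_forall fun ω => (le_sup_right : b.1 ω ≤ a.1 ω ⊔ b.1 ω)
  sup_le := by
    rintro ⟨a⟩ ⟨b⟩ ⟨c⟩ h h'
    change ∀ᵐ ω ∂lam, a.1 ω ≤ c.1 ω at h
    change ∀ᵐ ω ∂lam, b.1 ω ≤ c.1 ω at h'
    change ∀ᵐ ω ∂lam, a.1 ω ⊔ b.1 ω ≤ c.1 ω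
    filter_upwards [h, h'] with ω h1 h2 using sup_le h1 h2
  inf_le_left := by
    rintro ⟨a⟩ ⟨b⟩
    exact Eventually.of_forall fun ω => (inf_le_left : a.1 ω ⊓ b.1 ω ≤ a.1 ω)
  inf_le_right := by
    rintro ⟨a⟩ ⟨b⟩
    exact Eventually.of_forall fun ω => (inf_le_right : a.1 ω ⊓ b.1 ω ≤ b.1 ω)
  le_inf := by
    rintro ⟨a⟩ ⟨b⟩ ⟨c⟩ h h'
    change ∀ᵐ ω ∂lam, a.1 ω ≤ b.1 ω at h
    change ∀ᵐ ω ∂lam, a.1 ω ≤ c.1 ω at h'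
    change ∀ᵐ ω ∂lam, a.1 ω ≤ b.1 ω ⊓ c.1 ω
    filter_upwards [h, h'] with ω h1 h2 using le_inf h1 h2
  le_sup_inf := by
    rintro ⟨a⟩ ⟨b⟩ ⟨c⟩
    exact Eventually.of_forall fun ω =>
      (le_sup_inf : (a.1 ω ⊔ b.1 ω) ⊓ (a.1 ω ⊔ c.1 ω) ≤ a.1 ω ⊔ b.1 ω ⊓ c.1 ω)
  inf_compl_le_bot := by
    rintro ⟨a⟩
    exact Eventually.of_forall fun ω => (inf_compl_self (a.1 ω)).le
  top_le_sup_compl := by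
    rintro ⟨a⟩
    exact Eventually.of_forall fun ω => (sup_compl_eq_top (x := a.1 ω)).ge
  le_top := by
    rintro ⟨a⟩
    exact Eventually.of_forall fun ω => (le_top : a.1 ω ≤ ⊤)
  bot_le := by
    rintro ⟨a⟩
    exact Eventually.of_forall fun ω => (bot_le : ⊥ ≤ a.1 ω)

/-- `X.IsFibre fhat f` says that the section `ω ↦ f(ω) ∈ L₀(∇_ω, μ_ω)` is the one with which
`fhat ∈ L₀(Hat)` is identified: for every real `α`, the element `[fhat > α]` of `Hat` is the class of
a measurable section whose value at almost every `ω` is `[f(ω) > α]`. -/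
def IsFibre (fhat : LZero X.Hat) (f : ∀ ω, LZero (nab ω)) : Prop :=
  ∀ α : ℝ, ∃ e : X.M, fhat.IsLevel α (X.hat e) ∧ ∀ᵐ ω ∂lam, (f ω).IsLevel α (e.1 ω)

end BooleanBundle

/-!
An element `f` of `C_∞(Q(B))` is determined by its levels `[f > q]` at rational `q`. When `B` is
σ-complete, the families that arise in this way are exactly those that are continuous from the right
with supremum `⊤` and infimum `⊥` (`IsSpectral`, `LZero.isSpectral_levels`,
`LZero.exists_of_isSpectral`), and the order of `C_∞(Q(B))` is the order of the levels
(`LZero.le_iff_levels`). Consequently suprema of countable families in `C_∞(Q(B))` are computed level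
by level (`LZero.isLUB_iff_levels`), and a supremum exists if and only if
`⨅ q, ⨆ i, [f i > q] = ⊥` (`LZero.exists_isLUB_iff`). Everything is thus expressed by countably many
suprema and infima of countable families in `B`.

Such suprema pass between `Hat` and the fibres. The pointwise supremum of countably many measurable
sections is the limit, in the metrics `ρ_ω`, of its finite partial suprema, and an almost everywhere
limit of measurable sections is measurable: distances of sections are measurable functions, so on a
finite measure space step-sections can be selected that converge to the limit by the Borel–Cantelli
lemma (`BooleanBundle.isMeasurableSection_of_tendsto`). Hence `Hat` is σ-complete and a class is the
supremum of countably many classes if and only if it is so in almost every fibre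
(`BooleanBundle.isLUB_hat_iff`). Applied to the rational levels, this gives the section that
represents an element (`BooleanBundle.exists_isFibre`), its uniqueness (`BooleanBundle.IsFibre.ae_eq`)
and both assertions on suprema (`BooleanBundle.exists_isLUB_iff_ae`,
`BooleanBundle.ae_isLUB_of_isLUB`).
-/

/-! ### The Stone compact -/

namespace StoneCompact

variable {B : Type v} [BooleanAlgebra B]

theorem mem_clopen {b : B} {x : StoneCompact B} : x ∈ clopen b ↔ x b = true := Iff.rfl

theorem isClopen_clopen (b : B) : IsClopen (clopen b) := by
  have hc : Continuous fun x : StoneCompact B => x b :=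
    (continuous_apply b).comp continuous_induced_dom
  exact (isClopen_discrete {true}).preimage hc

theorem clopen_mono {a b : B} (h : a ≤ b) : clopen a ⊆ clopen b := fun x hx => by
  have := OrderHomClass.mono x h
  rw [mem_clopen.1 hx] at this
  exact top_le_iff.1 this

@[simp] theorem clopen_sup (a b : B) : clopen (a ⊔ b) = clopen a ∪ clopen b := by
  ext x; simp [mem_clopen]

@[simp] theorem clopen_inf (a b : B) : clopen (a ⊓ b) = clopen a ∩ clopen b := by
  ext x; simp [mem_clopen]

@[simp] theorem clopen_top : clopen (⊤ : B) = Set.univ := by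
  ext x; simp [mem_clopen]

@[simp] theorem clopen_bot : clopen (⊥ : B) = ∅ := by
  ext x; simp [mem_clopen]

@[simp] theorem clopen_compl (a : B) : clopen aᶜ = (clopen a)ᶜ := by
  refine (IsCompl.compl_eq ?_).symm
  rw [isCompl_iff, disjoint_iff, codisjoint_iff]
  change clopen a ∩ clopen aᶜ = ∅ ∧ clopen a ∪ clopen aᶜ = Set.univ
  rw [← clopen_inf, ← clopen_sup, inf_compl_self, sup_compl_eq_top, clopen_bot, clopen_top]
  exact ⟨rfl, rfl⟩

/-- Stone's separation theorem: a nonzero element lies in some ultrafilter. -/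
theorem clopen_nonempty {a : B} (ha : a ≠ ⊥) : (clopen a).Nonempty := by
  classical
  have hd : Disjoint (Order.PFilter.principal a : Set B) (Order.Ideal.principal (⊥ : B) : Set B) := by
    rw [Set.disjoint_left]
    intro x hx hx'
    have h1 : a ≤ x := hx
    have h2 : x ≤ ⊥ := hx'
    exact ha (le_bot_iff.1 (h1.trans h2))
  obtain ⟨J, hJ, -, hFJ⟩ := DistribLattice.prime_ideal_of_disjoint_filter_ideal hd
  have htop : (⊤ : B) ∉ J := fun h => Set.disjoint_left.1 hFJ (le_top : a ≤ ⊤) h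
  refine ⟨{ toFun := fun b => decide (b ∉ J)
            map_sup' := fun b c => ?_
            map_inf' := fun b c => ?_
            map_top' := by simpa using htop
            map_bot' := by simp }, ?_⟩
  · rw [Bool.eq_iff_iff]
    simp [Order.Ideal.sup_mem_iff]
  · have : b ⊓ c ∈ J ↔ b ∈ J ∨ c ∈ J :=
      ⟨hJ.mem_or_mem, fun h => h.elim (J.lower inf_le_left) (J.lower inf_le_right)⟩
    rw [Bool.eq_iff_iff]
    simp [this]
  · exact decide_eq_true (fun h => Set.disjoint_left.1 hFJ (le_refl a : a ≤ a) h)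

theorem clopen_subset_clopen {a b : B} : clopen a ⊆ clopen b ↔ a ≤ b := by
  refine ⟨fun h => ?_, clopen_mono⟩
  by_contra hab
  obtain ⟨x, hx⟩ := clopen_nonempty (a := a ⊓ bᶜ)
    (fun h0 => hab (by rwa [← disjoint_iff, disjoint_compl_right_iff] at h0))
  rw [clopen_inf, clopen_compl] at hx
  exact hx.2 (h hx.1)

theorem clopen_injective : Function.Injective (clopen : B → Set (StoneCompact B)) :=
  fun _ _ h => (clopen_subset_clopen.1 h.le).antisymm (clopen_subset_clopen.1 h.ge)

theorem clopen_finset_inf {ι : Type*} (s : Finset ι) (b : ι → B) :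
    clopen (s.inf b) = ⋂ i ∈ s, clopen (b i) := by
  classical
  induction s using Finset.induction_on with
  | empty => simp
  | insert i s _ ih => simp [Finset.inf_insert, ih]

theorem clopen_finset_sup {ι : Type*} (s : Finset ι) (b : ι → B) :
    clopen (s.sup b) = ⋃ i ∈ s, clopen (b i) := by
  classical
  induction s using Finset.induction_on with
  | empty => simp
  | insert i s _ ih => simp [Finset.sup_insert, ih]

/-- The sets `clopen b` form a base of the topology. -/
theorem exists_clopen_subset {U : Set (StoneCompact B)} (hU : IsOpen U) {x : StoneCompact B}
    (hx : x ∈ U) : ∃ b, x ∈ clopen b ∧ clopen b ⊆ U := by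
  obtain ⟨V, hV, rfl⟩ := isOpen_induced_iff.1 hU
  obtain ⟨I, u, hu, hIV⟩ := isOpen_pi_iff.1 hV _ hx
  refine ⟨I.inf fun b => if x b = true then b else bᶜ, ?_, fun y hy => hIV fun b hb => ?_⟩
  · rw [clopen_finset_inf, Set.mem_iInter₂]
    intro b _
    split_ifs with h
    · exact h
    · rwa [clopen_compl]
  · rw [clopen_finset_inf, Set.mem_iInter₂] at hy
    have hyb := hy b hb
    have : y b = x b := by
      split_ifs at hyb with h
      · rw [h]; exact hyb
      · rw [clopen_compl] at hyb
        rw [Bool.not_eq_true] at h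
        rw [h]; exact Bool.not_eq_true _ ▸ hyb
    change y b ∈ u b
    rw [this]
    exact (hu b hb).2

/-- The homomorphisms form a closed subset of the compact space `B → Bool`. -/
instance : CompactSpace (StoneCompact B) := by
  have hi : IsInducing (fun (x : StoneCompact B) (b : B) => x b) := ⟨rfl⟩
  have hr : IsClosed (Set.range fun (x : StoneCompact B) (b : B) => x b) := by
    have : (Set.range fun (x : StoneCompact B) (b : B) => x b) =
        {φ | (∀ a b, φ (a ⊔ b) = (φ a ⊔ φ b)) ∧ (∀ a b, φ (a ⊓ b) = (φ a ⊓ φ b)) ∧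
          φ ⊤ = ⊤ ∧ φ ⊥ = ⊥} := by
      ext φ
      constructor
      · rintro ⟨x, rfl⟩
        exact ⟨map_sup x, map_inf x, map_top x, map_bot x⟩
      · rintro ⟨h1, h2, h3, h4⟩
        exact ⟨⟨⟨⟨φ, h1⟩, h2⟩, h3, h4⟩, rfl⟩
    rw [this]
    have hc : ∀ F G : (B → Bool) → Bool, Continuous F → Continuous G →
        IsClosed {φ | F φ = G φ} := fun F G hF hG => isClosed_eq hF hG
    have hbin : ∀ op : Bool → Bool → Bool, ∀ a b : B,
        Continuous fun φ : B → Bool => op (φ a) (φ b) := fun op a b =>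
      (continuous_of_discreteTopology (f := fun p : Bool × Bool => op p.1 p.2)).comp
        (f := fun φ : B → Bool => (φ a, φ b))
        ((continuous_apply a).prodMk (continuous_apply b))
    simp only [Set.ofPred_and, Set.ofPred_forall]
    refine IsClosed.inter (isClosed_iInter fun a => isClosed_iInter fun b => hc _ _
      (continuous_apply _) (hbin _ a b)) (IsClosed.inter (isClosed_iInter fun a =>
        isClosed_iInter fun b => hc _ _ (continuous_apply _) (hbin _ a b)) (IsClosed.inter ?_ ?_))
    · exact hc _ _ (continuous_apply _) continuous_const
    · exact hc _ _ (continuous_apply _) continuous_const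
  rw [← isCompact_univ_iff, hi.isCompact_iff, Set.image_univ]
  exact hr.isCompact

/-- A closed set inside an open set can be separated from its complement by some `clopen b`. -/
theorem exists_clopen_between {K U : Set (StoneCompact B)} (hK : IsClosed K) (hU : IsOpen U)
    (h : K ⊆ U) : ∃ b, K ⊆ clopen b ∧ clopen b ⊆ U := by
  choose! b hb hbU using fun x (hx : x ∈ K) => exists_clopen_subset hU (h hx)
  obtain ⟨t, htK, ht⟩ := hK.isCompact.elim_nhds_subcover (fun x => clopen (b x))
    fun x hx => (isClopen_clopen (b x)).isOpen.mem_nhds (hb x hx)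
  refine ⟨t.sup b, ?_, ?_⟩ <;> rw [clopen_finset_sup]
  · exact ht
  · exact Set.iUnion₂_subset fun x hx => hbU x (htK x hx)

/-- Suprema in `B` correspond to closures of unions in the Stone compact. -/
theorem isLUB_range_iff {ι : Type*} {e : ι → B} {b : B} :
    IsLUB (Set.range e) b ↔ clopen b = closure (⋃ i, clopen (e i)) := by
  constructor
  · intro h
    refine Set.Subset.antisymm (fun x hx => ?_) (closure_minimal
      (Set.iUnion_subset fun i => clopen_mono (h.1 (Set.mem_range_self i)))
        (isClopen_clopen b).isClosed)
    by_contra hxc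
    obtain ⟨c, hc, hcU⟩ := exists_clopen_subset
      ((isClopen_clopen b).isOpen.inter isClosed_closure.isOpen_compl) ⟨hx, hxc⟩
    -- `c` misses every `e i`, so that `cᶜ` is an upper bound as well
    have hbc : b ≤ cᶜ := h.2 (by
      rintro _ ⟨i, rfl⟩
      rw [← clopen_subset_clopen, clopen_compl]
      exact fun y hy hyc => (hcU hyc).2 (subset_closure (Set.mem_iUnion_of_mem i hy)))
    have := clopen_mono hbc hx
    rw [clopen_compl] at this
    exact this hc
  · intro h
    refine ⟨?_, fun c hc => ?_⟩
    · rintro _ ⟨i, rfl⟩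
      rw [← clopen_subset_clopen, h]
      exact Set.Subset.trans (Set.subset_iUnion (fun i => clopen (e i)) i) subset_closure
    · rw [← clopen_subset_clopen, h]
      exact closure_minimal (Set.iUnion_subset fun i => clopen_mono (hc ⟨i, rfl⟩))
        (isClopen_clopen c).isClosed

end StoneCompact

/-! ### Elements of `C_∞(Q(B))` and their levels -/

/-- Every countable family in `B` has a supremum. -/
def IsSigmaComplete (B : Type v) [BooleanAlgebra B] : Prop :=
  ∀ e : ℕ → B, ∃ b, IsLUB (Set.range e) b

theorem isSigmaComplete_of_complete {B : Type v} [CompleteBooleanAlgebra B] : IsSigmaComplete B :=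
  fun e => ⟨⨆ i, e i, isLUB_iSup⟩

theorem IsSigmaComplete.exists_isLUB {B : Type v} [BooleanAlgebra B] (hB : IsSigmaComplete B)
    {ι : Type*} [Countable ι] (e : ι → B) : ∃ b, IsLUB (Set.range e) b := by
  cases isEmpty_or_nonempty ι
  · exact ⟨⊥, by simp [Set.range_eq_empty]⟩
  · obtain ⟨φ, hφ⟩ := exists_surjective_nat ι
    obtain ⟨b, hb⟩ := hB (e ∘ φ)
    exact ⟨b, by rwa [hφ.range_comp] at hb⟩

theorem isGLB_range_bot_iff {B : Type v} [BooleanAlgebra B] {ι : Type*} {c : ι → B} :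
    IsGLB (Set.range c) ⊥ ↔ IsLUB (Set.range fun i => (c i)ᶜ) ⊤ := by
  constructor
  · refine fun h => ⟨fun _ _ => le_top, fun u hu => ?_⟩
    have : uᶜ ≤ ⊥ := h.2 (by
      rintro _ ⟨i, rfl⟩
      exact compl_le_iff_compl_le.1 (hu ⟨i, rfl⟩))
    rw [le_bot_iff, compl_eq_bot] at this
    exact this.ge
  · refine fun h => ⟨fun _ _ => bot_le, fun u hu => ?_⟩
    have : ⊤ ≤ uᶜ := h.2 (by
      rintro _ ⟨i, rfl⟩
      exact compl_le_compl (hu ⟨i, rfl⟩))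
    rw [top_le_iff, compl_eq_top] at this
    exact this.le

/-- The families `q ↦ [f > q]` (`q` rational) of the elements `f` of `C_∞(Q(B))`: they are
continuous from the right, and the two limits say that `f` is finite on a dense set. -/
structure IsSpectral {B : Type v} [BooleanAlgebra B] (e : ℚ → B) : Prop where
  right : ∀ q, IsLUB (Set.range fun r : {r : ℚ // q < r} => e r) (e q)
  top : IsLUB (Set.range e) ⊤
  bot : IsGLB (Set.range e) ⊥

theorem IsSpectral.antitone {B : Type v} [BooleanAlgebra B] {e : ℚ → B} (he : IsSpectral e) :
    Antitone e := fun q r h => by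
  rcases h.eq_or_lt with rfl | h
  · exact le_rfl
  · exact (he.right q).1 ⟨⟨r, h⟩, rfl⟩

namespace LZero

open StoneCompact

variable {B : Type v} [BooleanAlgebra B]

instance : Nonempty (LZero B) :=
  ⟨⟨fun _ => 0, continuous_const, by simp⟩⟩

theorem isOpen_gt (f : LZero B) (a : EReal) : IsOpen {x | a < f.toFun x} :=
  isOpen_lt continuous_const f.continuous_toFun

theorem isClosed_ge (f : LZero B) (a : EReal) : IsClosed {x | a ≤ f.toFun x} :=
  isClosed_le continuous_const f.continuous_toFun

theorem IsLevel.unique {f : LZero B} {α : ℝ} {a b : B} (ha : f.IsLevel α a)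
    (hb : f.IsLevel α b) : a = b :=
  clopen_injective (Eq.trans ha (Eq.symm hb))

theorem IsLevel.gt_subset {f : LZero B} {α : ℝ} {a : B} (ha : f.IsLevel α a) :
    {x | (α : EReal) < f.toFun x} ⊆ clopen a := by
  rw [show clopen a = _ from ha]
  exact subset_closure

theorem IsLevel.subset_ge {f : LZero B} {α : ℝ} {a : B} (ha : f.IsLevel α a) :
    clopen a ⊆ {x | (α : EReal) ≤ f.toFun x} := by
  rw [show clopen a = _ from ha]
  exact closure_minimal (fun x hx => le_of_lt (α := EReal) hx) (f.isClosed_ge α)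

theorem exists_rat_between {a : ℝ} {b : EReal} (h : (a : EReal) < b) :
    ∃ q : ℚ, a < q ∧ (((q : ℚ) : ℝ) : EReal) < b := by
  obtain ⟨q, h1, h2⟩ := EReal.lt_iff_exists_rat_btwn.1 h
  exact ⟨q, EReal.coe_lt_coe_iff.1 h1, h2⟩

/-- The open set `{f > α}` is a countable union of sets `clopen b`, whose supremum is `[f > α]`. -/
theorem exists_isLevel (hB : IsSigmaComplete B) (f : LZero B) (α : ℝ) : ∃ b, f.IsLevel α b := by
  have key : ∀ q : {q : ℚ // α < q}, ∃ b, {x | (((q : ℚ) : ℝ) : EReal) ≤ f.toFun x} ⊆ clopen b ∧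
      clopen b ⊆ {x | (α : EReal) < f.toFun x} := fun q =>
    exists_clopen_between (f.isClosed_ge _) (f.isOpen_gt _) fun x hx =>
      (EReal.coe_lt_coe_iff.2 q.2).trans_le hx
  choose e he1 he2 using key
  obtain ⟨b, hb⟩ := hB.exists_isLUB e
  refine ⟨b, ?_⟩
  have : ⋃ i, clopen (e i) = {x | (α : EReal) < f.toFun x} := by
    refine Set.Subset.antisymm (Set.iUnion_subset he2) fun x hx => ?_
    obtain ⟨q, h1, h2⟩ := exists_rat_between hx
    exact Set.mem_iUnion_of_mem ⟨q, h1⟩ (he1 ⟨q, h1⟩ h2.le)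
  rw [isLUB_range_iff, this] at hb
  exact hb

/-- Since `clopen [f > r] ⊆ {f ≥ r}`, no closure is needed here. -/
theorem iUnion_clopen_levels {f : LZero B} {e : ℚ → B} (he : ∀ q : ℚ, f.IsLevel q (e q)) (α : ℝ) :
    ⋃ r : {r : ℚ // α < r}, clopen (e r) = {x | (α : EReal) < f.toFun x} := by
  refine Set.Subset.antisymm (Set.iUnion_subset fun r x hx => ?_) fun x hx => ?_
  · exact (EReal.coe_lt_coe_iff.2 r.2).trans_le ((he r).subset_ge hx)
  · obtain ⟨q, h1, h2⟩ := exists_rat_between hx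
    exact Set.mem_iUnion_of_mem ⟨q, h1⟩ ((he q).gt_subset h2)

/-- The levels at rational numbers determine all levels. -/
theorem isLevel_iff_isLUB {f : LZero B} {e : ℚ → B} (he : ∀ q : ℚ, f.IsLevel q (e q)) {α : ℝ}
    {a : B} : f.IsLevel α a ↔ IsLUB (Set.range fun r : {r : ℚ // α < r} => e r) a := by
  rw [isLUB_range_iff, iUnion_clopen_levels he]
  rfl

theorem le_iff_levels {f g : LZero B} {a b : ℚ → B} (ha : ∀ q : ℚ, f.IsLevel q (a q))
    (hb : ∀ q : ℚ, g.IsLevel q (b q)) : f ≤ g ↔ ∀ q, a q ≤ b q := by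
  constructor
  · intro h q
    rw [← clopen_subset_clopen, show clopen (a q) = _ from ha q, show clopen (b q) = _ from hb q]
    exact closure_mono fun x hx => lt_of_lt_of_le hx (h x)
  · intro h x
    by_contra! hx
    obtain ⟨q, h1, h2⟩ := EReal.lt_iff_exists_rat_btwn.1 hx
    exact absurd ((hb q).subset_ge (clopen_mono (h q) ((ha q).gt_subset h2))) (not_le.2 h1)

theorem eq_of_levels {f g : LZero B} {a : ℚ → B} (hf : ∀ q : ℚ, f.IsLevel q (a q))
    (hg : ∀ q : ℚ, g.IsLevel q (a q)) : f = g :=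
  ((le_iff_levels hf hg).2 fun _ => le_rfl).antisymm ((le_iff_levels hg hf).2 fun _ => le_rfl)

theorem isSpectral_levels {f : LZero B} {e : ℚ → B} (he : ∀ q : ℚ, f.IsLevel q (e q)) :
    IsSpectral e where
  right q := by
    convert (isLevel_iff_isLUB he).1 (he q) using 1
    ext b
    simp
  top := by
    rw [isLUB_range_iff, clopen_top, eq_comm, ← dense_iff_closure_eq]
    refine f.dense_finite.mono fun x hx => ?_
    obtain ⟨q, -, h2⟩ := EReal.lt_iff_exists_rat_btwn.1 (bot_lt_iff_ne_bot.2 hx.1)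
    exact Set.mem_iUnion_of_mem q ((he q).gt_subset h2)
  bot := by
    refine ⟨fun _ _ => bot_le, fun c hc => ?_⟩
    by_contra h0
    obtain ⟨x, hx, hfin⟩ := f.dense_finite.inter_open_nonempty _ (isClopen_clopen c).isOpen
      (clopen_nonempty fun h => h0 h.le)
    obtain ⟨q, h1, -⟩ := EReal.lt_iff_exists_rat_btwn.1 (lt_top_iff_ne_top.2 hfin.2)
    exact absurd ((he q).subset_ge (clopen_mono (hc ⟨q, rfl⟩) hx)) (not_le.2 h1)

/-- Every spectral family is the family of levels of the function
`x ↦ sup {q | x ∈ clopen (e q)}`. -/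
theorem exists_of_isSpectral {e : ℚ → B} (he : IsSpectral e) :
    ∃ f : LZero B, ∀ q : ℚ, f.IsLevel q (e q) := by
  classical
  let F : StoneCompact B → EReal := fun x => ⨆ q : {q : ℚ // x ∈ clopen (e q)}, ((q : ℚ) : ℝ)
  have hgt : ∀ a : EReal, {x | a < F x} = ⋃ q : {q : ℚ // a < ((q : ℝ) : EReal)}, clopen (e q) := by
    intro a
    ext x
    simp only [F, Set.mem_ofPred_eq, lt_iSup_iff, Set.mem_iUnion, Subtype.exists, exists_prop]
    exact exists_congr fun q => and_comm
  have hlt : ∀ a : EReal, {x | F x < a} =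
      ⋃ q : {q : ℚ // ((q : ℝ) : EReal) < a}, (clopen (e q))ᶜ := by
    intro a
    ext x
    simp only [Set.mem_ofPred_eq, Set.mem_iUnion, Set.mem_compl_iff]
    constructor
    · intro h
      obtain ⟨q, h1, h2⟩ := EReal.lt_iff_exists_rat_btwn.1 h
      exact ⟨⟨q, h2⟩, fun hx => absurd h1 (not_lt.2
        (le_iSup (fun q : {q : ℚ // x ∈ clopen (e q)} => (((q : ℚ) : ℝ) : EReal)) ⟨q, hx⟩))⟩
    · rintro ⟨⟨q, hq⟩, hx⟩
      refine lt_of_le_of_lt (iSup_le fun r => ?_) hq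
      rw [EReal.coe_le_coe_iff, Rat.cast_le]
      by_contra! hr
      exact hx (clopen_mono (he.antitone hr.le) r.2)
  have hc : Continuous F := by
    refine OrderTopology.continuous_iff.2 fun a => ⟨?_, ?_⟩
    · change IsOpen {x | a < F x}
      rw [hgt]
      exact isOpen_iUnion fun q => (isClopen_clopen _).isOpen
    · change IsOpen {x | F x < a}
      rw [hlt]
      exact isOpen_iUnion fun q => (isClopen_clopen _).compl.isOpen
  have hlev : ∀ q : ℚ, clopen (e q) = closure {x | (((q : ℚ) : ℝ) : EReal) < F x} := by
    intro q
    have := isLUB_range_iff.1 (he.right q)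
    rw [hgt, this]
    congr 1
    ext x
    simp
  have hd1 : Dense {x | ⊥ < F x} := by
    have := isLUB_range_iff.1 he.top
    rw [clopen_top, eq_comm, ← dense_iff_closure_eq] at this
    refine this.mono (Set.iUnion_subset fun q x hx => ?_)
    exact lt_of_lt_of_le (EReal.bot_lt_coe _)
      (le_iSup (fun q : {q : ℚ // x ∈ clopen (e q)} => (((q : ℚ) : ℝ) : EReal)) ⟨q, hx⟩)
  have hd2 : Dense {x | F x < ⊤} := by
    rw [dense_iff_inter_open]
    rintro U hU ⟨x, hx⟩
    obtain ⟨c, hxc, hcU⟩ := exists_clopen_subset hU hx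
    by_contra hne
    -- otherwise `F = ⊤` on `clopen c`, which puts `c` below all levels
    have hcb : c ≤ ⊥ := he.bot.2 (by
      rintro _ ⟨q, rfl⟩
      rw [← clopen_subset_clopen, hlev]
      refine Set.Subset.trans (fun y hy => ?_) subset_closure
      by_contra hlt'
      exact hne ⟨y, hcU hy, (not_lt.1 hlt').trans_lt (EReal.coe_lt_top _)⟩)
    rw [le_bot_iff.1 hcb, clopen_bot] at hxc
    exact hxc
  refine ⟨⟨F, hc, ?_⟩, hlev⟩
  exact (hd1.inter_of_isOpen_left hd2 (isOpen_lt continuous_const hc)).mono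
    fun x hx => ⟨hx.1.ne', hx.2.ne⟩

section Suprema

variable {ι : Type*} {f : ι → LZero B} {e : ι → ℚ → B} {c : ℚ → B}

theorem isSpectral_sup [Nonempty ι] (he : ∀ i, IsSpectral (e i))
    (hc : ∀ q, IsLUB (Set.range fun i => e i q) (c q)) (h0 : IsGLB (Set.range c) ⊥) :
    IsSpectral c where
  right q := by
    constructor
    · rintro _ ⟨r, rfl⟩
      refine (hc r).2 ?_
      rintro _ ⟨i, rfl⟩
      exact ((he i).antitone r.2.le).trans ((hc q).1 ⟨i, rfl⟩)
    · intro u hu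
      refine (hc q).2 ?_
      rintro _ ⟨i, rfl⟩
      refine ((he i).right q).2 ?_
      rintro _ ⟨r, rfl⟩
      exact ((hc r).1 ⟨i, rfl⟩).trans (hu ⟨r, rfl⟩)
  top := by
    refine ⟨fun _ _ => le_top, fun u hu => ?_⟩
    obtain ⟨i⟩ := ‹Nonempty ι›
    refine (he i).top.2 ?_
    rintro _ ⟨q, rfl⟩
    exact ((hc q).1 ⟨i, rfl⟩).trans (hu ⟨q, rfl⟩)
  bot := h0

theorem isLUB_of_levels (hB : IsSigmaComplete B) {g : LZero B}
    (he : ∀ i (q : ℚ), (f i).IsLevel q (e i q)) (hg : ∀ q : ℚ, g.IsLevel q (c q))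
    (hc : ∀ q, IsLUB (Set.range fun i => e i q) (c q)) : IsLUB (Set.range f) g := by
  constructor
  · rintro _ ⟨i, rfl⟩
    exact (le_iff_levels (he i) hg).2 fun q => (hc q).1 ⟨i, rfl⟩
  · intro h hh
    choose b hb using fun q : ℚ => h.exists_isLevel hB q
    refine (le_iff_levels hg hb).2 fun q => (hc q).2 ?_
    rintro _ ⟨i, rfl⟩
    exact (le_iff_levels (he i) hb).1 (hh ⟨i, rfl⟩) q

/-- A nonempty family in `C_∞(Q(B))` has a supremum if and only if
`⨅ q, ⨆ i, [f i > q] = ⊥`: this is what makes the suprema of the levels a spectral family. -/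
theorem exists_isLUB_iff (hB : IsSigmaComplete B) [Nonempty ι]
    (he : ∀ i (q : ℚ), (f i).IsLevel q (e i q))
    (hc : ∀ q, IsLUB (Set.range fun i => e i q) (c q)) :
    (∃ g, IsLUB (Set.range f) g) ↔ IsGLB (Set.range c) ⊥ := by
  constructor
  · rintro ⟨g, hg⟩
    choose b hb using fun q : ℚ => g.exists_isLevel hB q
    refine ⟨fun _ _ => bot_le, fun u hu => (isSpectral_levels hb).bot.2 ?_⟩
    rintro _ ⟨q, rfl⟩
    refine (hu ⟨q, rfl⟩).trans ((hc q).2 ?_)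
    rintro _ ⟨i, rfl⟩
    exact (le_iff_levels (he i) hb).1 (hg.1 ⟨i, rfl⟩) q
  · intro h0
    obtain ⟨g, hg⟩ := exists_of_isSpectral
      (isSpectral_sup (fun i => isSpectral_levels (he i)) hc h0)
    exact ⟨g, isLUB_of_levels hB he hg hc⟩

/-- Suprema of countable families in `C_∞(Q(B))` are computed level by level. -/
theorem isLUB_iff_levels (hB : IsSigmaComplete B) [Nonempty ι] [Countable ι] {g : LZero B}
    {b : ℚ → B} (he : ∀ i (q : ℚ), (f i).IsLevel q (e i q)) (hg : ∀ q : ℚ, g.IsLevel q (b q)) :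
    IsLUB (Set.range f) g ↔ ∀ q, IsLUB (Set.range fun i => e i q) (b q) := by
  refine ⟨fun h => ?_, isLUB_of_levels hB he hg⟩
  choose c hc using fun q : ℚ => hB.exists_isLUB fun i => e i q
  have h0 := (exists_isLUB_iff hB he hc).1 ⟨g, h⟩
  obtain ⟨g', hg'⟩ := exists_of_isSpectral
    (isSpectral_sup (fun i => isSpectral_levels (he i)) hc h0)
  have : g' = g := (isLUB_of_levels hB he hg' hc).unique h
  subst this
  intro q
  rw [(hg q).unique (hg' q)]
  exact hc q

end Suprema

end LZero

/-! ### The metric of a strictly positive measure -/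

namespace StrictMeasure

variable {B : Type v}

theorem dist_comm [BooleanAlgebra B] (m : StrictMeasure B) (a b : B) : m.dist a b = m.dist b a := by
  simp only [dist, symmDiff_comm]

theorem dist_triangle [BooleanAlgebra B] (m : StrictMeasure B) (a b c : B) :
    m.dist a c ≤ m.dist a b + m.dist b c :=
  (m.mono (symmDiff_triangle a b c)).trans (m.val_sup_le _ _)

theorem abs_dist_sub_dist_le [BooleanAlgebra B] (m : StrictMeasure B) (a b c : B) :
    |m.dist a b - m.dist a c| ≤ m.dist b c := by
  have h1 := m.dist_triangle a b c
  have h2 := m.dist_triangle a c b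
  rw [m.dist_comm c b] at h2
  exact abs_sub_le_iff.2 ⟨by linarith, by linarith⟩

/-- The countable additivity of the measure, in the form of convergence in the metric. -/
theorem tendsto_dist_partialSups [CompleteBooleanAlgebra B] (m : StrictMeasure B) (e : ℕ → B) :
    Tendsto (fun n => m.dist (partialSups e n) (⨆ i, e i)) atTop (𝓝 0) := by
  have hle : ∀ n, partialSups e n ≤ ⨆ i, e i := fun n =>
    (le_iSup (fun n => partialSups e n) n).trans (iSup_partialSups_eq e).le
  have hd : ∀ n, m.dist (partialSups e n) (⨆ i, e i) = m.val ((⨆ i, e i) \ partialSups e n) :=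
    fun n => by rw [dist, symmDiff_of_le (hle n)]
  simp only [hd]
  refine m.continuous _ (fun n k h => sdiff_le_sdiff_left ((partialSups e).monotone h))
    ⟨fun _ _ => bot_le, fun c hc => ?_⟩
  have h1 : ∀ n, c ≤ (⨆ i, e i) \ partialSups e n := fun n => hc ⟨n, rfl⟩
  have h2 : Disjoint c (⨆ i, e i) := by
    rw [disjoint_iSup_iff]
    exact fun i => disjoint_sdiff_self_left.mono (h1 i) (le_partialSups e i)
  exact (h2 le_rfl ((h1 0).trans sdiff_le))

end StrictMeasure

/-! ### Measurable sections -/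

namespace BooleanBundle

variable {Ω : Type u} [MeasurableSpace Ω] {lam : Measure Ω} {nab : Ω → Type v}
  [∀ ω, CompleteBooleanAlgebra (nab ω)] {X : BooleanBundle lam nab}

/-- On each piece of a common partition of the base the distance agrees with that of two members
of `L`. -/
theorem IsStep.aemeasurable_dist {s t : ∀ ω, nab ω} (hs : X.IsStep s) (ht : X.IsStep t) :
    AEMeasurable (fun ω => (X.μ ω).dist (s ω) (t ω)) lam := by
  obtain ⟨ι, hι, A, e, hA, -, he, hc, hs⟩ := hs.exists_cover
  obtain ⟨κ, hκ, A', e', hA', -, he', hc', ht⟩ := ht.exists_cover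
  have hU : ⋃ p : ι × κ, A p.1 ∩ A' p.2 = Set.univ := by
    refine Set.eq_univ_of_forall fun ω => ?_
    obtain ⟨i, hi⟩ := hc ω
    obtain ⟨j, hj⟩ := hc' ω
    exact Set.mem_iUnion_of_mem (i, j) ⟨hi, hj⟩
  suffices h : ∀ p : ι × κ, AEMeasurable (fun ω => (X.μ ω).dist (s ω) (t ω))
      (lam.restrict (A p.1 ∩ A' p.2)) by
    have := aemeasurable_iUnion_iff.2 h
    rwa [hU, Measure.restrict_univ] at this
  rintro ⟨i, j⟩
  obtain ⟨r, hr, hre⟩ := X.measurable_dist _ (he i) _ (he' j)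
  refine ⟨r, hr, ?_⟩
  rw [EventuallyEq, ae_restrict_iff' ((hA i).inter (hA' j))]
  filter_upwards [hs, ht, hre, (e i).ae_dom, (e' j).ae_dom] with ω h1 h2 h3 h4 h5 h6
  rw [h1 i h6.1 h4, h2 j h6.2 h5, h3 h4 h5]

theorem IsStep.aemeasurable_dist_section {s e : ∀ ω, nab ω} (hs : X.IsStep s)
    (he : X.IsMeasurableSection e) :
    AEMeasurable (fun ω => (X.μ ω).dist (s ω) (e ω)) lam := by
  obtain ⟨t, ht, hte⟩ := he
  refine aemeasurable_of_tendsto_metrizable_ae atTop (fun n => hs.aemeasurable_dist (ht n)) ?_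
  filter_upwards [hte] with ω hω
  rw [tendsto_iff_dist_tendsto_zero]
  exact squeeze_zero (fun _ => _root_.dist_nonneg)
    (fun n => (X.μ ω).abs_dist_sub_dist_le _ _ _) hω

/-- A step-section approximates a measurable section in measure, as closely as desired. -/
theorem IsMeasurableSection.exists_isStep_measure_lt [IsFiniteMeasure lam] {e : ∀ ω, nab ω}
    (he : X.IsMeasurableSection e) {δ : ℝ} (hδ : 0 < δ) {ε : ENNReal} (hε : 0 < ε) :
    ∃ s, X.IsStep s ∧ lam {ω | δ ≤ (X.μ ω).dist (s ω) (e ω)} < ε := by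
  obtain ⟨t, ht, hte⟩ := id he
  have hm : TendstoInMeasure lam (fun n ω => (X.μ ω).dist (t n ω) (e ω)) atTop fun _ => (0 : ℝ) :=
    tendstoInMeasure_of_tendsto_ae
      (fun n => ((ht n).aemeasurable_dist_section he).aestronglyMeasurable) hte
  obtain ⟨n, hn⟩ := ((tendstoInMeasure_iff_dist.1 hm δ hδ).eventually_lt_const hε).exists
  refine ⟨t n, ht n, lt_of_le_of_lt (measure_mono fun ω hω => ?_) hn⟩
  change δ ≤ dist ((X.μ ω).dist (t n ω) (e ω)) 0
  rw [Real.dist_0_eq_abs]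
  exact le_trans (show δ ≤ (X.μ ω).dist (t n ω) (e ω) from hω) (le_abs_self _)

/-- An almost everywhere limit of measurable sections is measurable: step-sections chosen close to
the members of the sequence converge to the limit by the Borel–Cantelli lemma. -/
theorem isMeasurableSection_of_tendsto [IsFiniteMeasure lam] {e : ℕ → ∀ ω, nab ω} {g : ∀ ω, nab ω}
    (he : ∀ n, X.IsMeasurableSection (e n))
    (h : ∀ᵐ ω ∂lam, Tendsto (fun n => (X.μ ω).dist (e n ω) (g ω)) atTop (𝓝 0)) :
    X.IsMeasurableSection g := by
  obtain ⟨ε, hε, hsum⟩ := ENNReal.exists_pos_sum_of_countable' (one_ne_zero (α := ENNReal)) ℕ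
  choose s hs hsε using fun n : ℕ =>
    (he n).exists_isStep_measure_lt (Nat.one_div_pos_of_nat (α := ℝ) (n := n)) (hε n)
  refine ⟨s, hs, ?_⟩
  have hBC := ae_eventually_notMem
    (ne_top_of_le_ne_top (hsum.trans ENNReal.one_lt_top).ne
      (ENNReal.tsum_le_tsum fun n => (hsε n).le))
  filter_upwards [h, hBC] with ω h1 h2
  refine squeeze_zero' (Eventually.of_forall fun n => (X.μ ω).dist_nonneg _ _)
    (h2.mono fun n hn => ?_)
    (by simpa only [add_zero] using tendsto_one_div_add_atTop_nhds_zero_nat.add h1)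
  exact ((X.μ ω).dist_triangle _ (e n ω) _).trans (by gcongr; exact (not_le.1 hn).le)

/-- The finite partial suprema are measurable sections that converge to the supremum in every
fibre. -/
theorem IsMeasurableSection.iSup_nat [IsFiniteMeasure lam] {e : ℕ → ∀ ω, nab ω}
    (he : ∀ n, X.IsMeasurableSection (e n)) : X.IsMeasurableSection fun ω => ⨆ n, e n ω := by
  have hp : ∀ n, X.IsMeasurableSection (partialSups e n) := by
    intro n
    induction n with
    | zero => simpa using he 0
    | succ n ih => simpa using ih.sup (he (n + 1))
  refine isMeasurableSection_of_tendsto hp (Eventually.of_forall fun ω => ?_)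
  simpa only [Pi.partialSups_apply] using (X.μ ω).tendsto_dist_partialSups fun n => e n ω

theorem IsMeasurableSection.iSup [IsFiniteMeasure lam] {ι : Type*} [Countable ι]
    {e : ι → ∀ ω, nab ω} (he : ∀ i, X.IsMeasurableSection (e i)) :
    X.IsMeasurableSection fun ω => ⨆ i, e i ω := by
  cases isEmpty_or_nonempty ι
  · simp only [iSup_of_empty]
    exact IsMeasurableSection.bot
  · obtain ⟨φ, hφ⟩ := exists_surjective_nat ι
    simpa only [hφ.iSup_comp fun i => e i _] using iSup_nat fun n => he (φ n)

/-! ### Classes of measurable sections -/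

theorem hat_surjective : Function.Surjective X.hat := Quotient.exists_rep

theorem hat_eq_hat_iff {a b : X.M} : X.hat a = X.hat b ↔ ∀ᵐ ω ∂lam, a.1 ω = b.1 ω :=
  Quotient.eq (r := X.aeSetoid)

theorem hat_le_hat_iff {a b : X.M} : X.hat a ≤ X.hat b ↔ ∀ᵐ ω ∂lam, a.1 ω ≤ b.1 ω := Iff.rfl

theorem isLUB_hat_of_ae {ι : Type*} [Countable ι] {e : ι → X.M} {a : X.M}
    (h : ∀ᵐ ω ∂lam, IsLUB (Set.range fun i => (e i).1 ω) (a.1 ω)) :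
    IsLUB (Set.range fun i => X.hat (e i)) (X.hat a) := by
  constructor
  · rintro _ ⟨i, rfl⟩
    exact hat_le_hat_iff.2 (h.mono fun ω hω => hω.1 ⟨i, rfl⟩)
  · intro u hu
    obtain ⟨b, rfl⟩ := hat_surjective u
    have hb : ∀ᵐ ω ∂lam, ∀ i, (e i).1 ω ≤ b.1 ω :=
      ae_all_iff.2 fun i => hat_le_hat_iff.1 (hu ⟨i, rfl⟩)
    rw [hat_le_hat_iff]
    filter_upwards [h, hb] with ω h1 h2
    exact h1.2 (Set.forall_mem_range.2 h2)

theorem IsFibre.exists_levels {fhat : LZero X.Hat} {f : ∀ ω, LZero (nab ω)}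
    (h : X.IsFibre fhat f) : ∃ e : ℚ → X.M, (∀ q : ℚ, fhat.IsLevel q (X.hat (e q))) ∧
      ∀ᵐ ω ∂lam, ∀ q : ℚ, (f ω).IsLevel q ((e q).1 ω) := by
  choose e h1 h2 using fun q : ℚ => h q
  exact ⟨e, h1, ae_all_iff.2 h2⟩

theorem IsFibre.ae_eq {fhat : LZero X.Hat} {f f' : ∀ ω, LZero (nab ω)} (h : X.IsFibre fhat f)
    (h' : X.IsFibre fhat f') : ∀ᵐ ω ∂lam, f' ω = f ω := by
  obtain ⟨e, he, hf⟩ := h.exists_levels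
  obtain ⟨e', he', hf'⟩ := h'.exists_levels
  have hee : ∀ᵐ ω ∂lam, ∀ q, (e q).1 ω = (e' q).1 ω :=
    ae_all_iff.2 fun q => hat_eq_hat_iff.1 ((he q).unique (he' q))
  filter_upwards [hf, hf', hee] with ω h1 h2 h3
  exact LZero.eq_of_levels h2 fun q => h3 q ▸ h1 q

variable [IsFiniteMeasure lam]

theorem exists_fibrewise_iSup {ι : Type*} [Countable ι] (e : ι → X.M) :
    ∃ a : X.M, ∀ ω, IsLUB (Set.range fun i => (e i).1 ω) (a.1 ω) :=
  ⟨⟨fun ω => ⨆ i, (e i).1 ω, IsMeasurableSection.iSup fun i => (e i).2⟩, fun _ => isLUB_iSup⟩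

theorem isSigmaComplete_hat : IsSigmaComplete X.Hat := by
  intro e
  choose e' he' using fun n => hat_surjective (e n)
  obtain ⟨a, ha⟩ := exists_fibrewise_iSup e'
  exact ⟨X.hat a, by simpa only [he'] using isLUB_hat_of_ae (Eventually.of_forall ha)⟩

/-- Suprema of countable families of classes are computed fibrewise. -/
theorem isLUB_hat_iff {ι : Type*} [Countable ι] {e : ι → X.M} {a : X.M} :
    IsLUB (Set.range fun i => X.hat (e i)) (X.hat a) ↔
      ∀ᵐ ω ∂lam, IsLUB (Set.range fun i => (e i).1 ω) (a.1 ω) := by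
  refine ⟨fun h => ?_, isLUB_hat_of_ae⟩
  obtain ⟨b, hb⟩ := exists_fibrewise_iSup e
  have hab : X.hat a = X.hat b := h.unique (isLUB_hat_of_ae (Eventually.of_forall hb))
  filter_upwards [hat_eq_hat_iff.1 hab] with ω hω
  rw [hω]
  exact hb ω

theorem isGLB_hat_bot_iff {ι : Type*} [Countable ι] {e : ι → X.M} :
    IsGLB (Set.range fun i => X.hat (e i)) ⊥ ↔
      ∀ᵐ ω ∂lam, IsGLB (Set.range fun i => (e i).1 ω) ⊥ := by
  simp only [isGLB_range_bot_iff]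
  exact isLUB_hat_iff (X := X) (e := fun i => (e i)ᶜ) (a := ⊤)

/-! ### Fibres of elements of `C_∞(Q(Hat))` -/

theorem ae_isSpectral {e : ℚ → X.M} (h : IsSpectral fun q => X.hat (e q)) :
    ∀ᵐ ω ∂lam, IsSpectral fun q => (e q).1 ω := by
  have htop : ∀ᵐ ω ∂lam, IsLUB (Set.range fun q => (e q).1 ω) ⊤ :=
    (isLUB_hat_iff (X := X) (a := ⊤)).1 h.top
  filter_upwards [ae_all_iff.2 fun q => isLUB_hat_iff.1 (h.right q), htop,
    isGLB_hat_bot_iff.1 h.bot] with ω h1 h2 h3 using ⟨h1, h2, h3⟩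

/-- The identification of an element with a section may be tested on rational levels. -/
theorem isFibre_of_rat {fhat : LZero X.Hat} {f : ∀ ω, LZero (nab ω)} {e : ℚ → X.M}
    (hhat : ∀ q : ℚ, fhat.IsLevel q (X.hat (e q)))
    (hf : ∀ᵐ ω ∂lam, ∀ q : ℚ, (f ω).IsLevel q ((e q).1 ω)) : X.IsFibre fhat f := by
  intro α
  obtain ⟨a, ha⟩ := exists_fibrewise_iSup fun r : {r : ℚ // α < r} => e r
  refine ⟨a, (LZero.isLevel_iff_isLUB hhat).2 (isLUB_hat_of_ae (Eventually.of_forall ha)), ?_⟩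
  filter_upwards [hf] with ω hω
  exact (LZero.isLevel_iff_isLUB hω).2 (ha ω)

/-- Representatives of the rational levels of `fhat` form a spectral family in almost every fibre;
on the remaining null set the value of the section is arbitrary. -/
theorem exists_isFibre (fhat : LZero X.Hat) : ∃ f : ∀ ω, LZero (nab ω), X.IsFibre fhat f := by
  classical
  choose b hb using fun q : ℚ => fhat.exists_isLevel isSigmaComplete_hat q
  choose e he using fun q => hat_surjective (b q)
  simp only [← he] at hb
  have hs := ae_isSpectral (LZero.isSpectral_levels hb)
  have : ∀ ω, ∃ f : LZero (nab ω), IsSpectral (fun q => (e q).1 ω) →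
      ∀ q : ℚ, f.IsLevel q ((e q).1 ω) := fun ω => by
    by_cases h : IsSpectral fun q => (e q).1 ω
    · exact (LZero.exists_of_isSpectral h).imp fun f hf _ => hf
    · exact ⟨Classical.arbitrary _, fun h' => absurd h' h⟩
  choose f hf using this
  exact ⟨f, isFibre_of_rat hb (hs.mono hf)⟩

section Suprema

variable {ι : Type*} [Countable ι] [Nonempty ι] {fhat : ι → LZero X.Hat}
  {f : ι → ∀ ω, LZero (nab ω)}

/-- The condition `⨅ q, ⨆ i, [f i > q] = ⊥` for the existence of a supremum involves only countable
suprema and infima, so it holds in `Hat` exactly when it holds in almost every fibre. -/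
theorem exists_isLUB_iff_ae (hf : ∀ i, X.IsFibre (fhat i) (f i)) :
    (∃ ghat, IsLUB (Set.range fhat) ghat) ↔
      ∀ᵐ ω ∂lam, ∃ g, IsLUB (Set.range fun i => f i ω) g := by
  choose e he hfe using fun i => (hf i).exists_levels
  choose c hc using fun q => exists_fibrewise_iSup fun i => e i q
  rw [LZero.exists_isLUB_iff isSigmaComplete_hat he
    fun q => isLUB_hat_of_ae (Eventually.of_forall (hc q)), isGLB_hat_bot_iff]
  refine eventually_congr ?_
  filter_upwards [ae_all_iff.2 hfe] with ω hω
  exact (LZero.exists_isLUB_iff isSigmaComplete_of_complete hω fun q => hc q ω).symm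

/-- The rational levels of the supremum are the suprema of the levels, in `Hat` and hence in almost
every fibre. -/
theorem ae_isLUB_of_isLUB (hf : ∀ i, X.IsFibre (fhat i) (f i)) {ghat : LZero X.Hat}
    (h : IsLUB (Set.range fhat) ghat) {g : ∀ ω, LZero (nab ω)} (hg : X.IsFibre ghat g) :
    ∀ᵐ ω ∂lam, IsLUB (Set.range fun i => f i ω) (g ω) := by
  choose e he hfe using fun i => (hf i).exists_levels
  obtain ⟨b, hb, hgb⟩ := hg.exists_levels
  have hlev := (LZero.isLUB_iff_levels isSigmaComplete_hat he hb).1 h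
  filter_upwards [ae_all_iff.2 hfe, hgb, ae_all_iff.2 fun q => isLUB_hat_iff.1 (hlev q)]
    with ω h1 h2 h3
  exact LZero.isLUB_of_levels isSigmaComplete_of_complete h1 h2 h3

end Suprema

end BooleanBundle

theorem mainTheorem6 {Ω : Type u} [MeasurableSpace Ω] (lam : Measure Ω) [IsFiniteMeasure lam]
    {nab : Ω → Type v} [∀ ω, CompleteBooleanAlgebra (nab ω)] (X : BooleanBundle lam nab)
    (d : ℕ) :
    -- every `fhat` is identified with a section `f`, unique up to equality almost everywhere
    (∀ fhat : LZero X.Hat, ∃ f : ∀ ω, LZero (nab ω), X.IsFibre fhat f ∧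
      ∀ f' : ∀ ω, LZero (nab ω), X.IsFibre fhat f' → ∀ᵐ ω ∂lam, f' ω = f ω) ∧
    ∀ (fhat : (Fin d → ℕ) → LZero X.Hat) (f : (Fin d → ℕ) → ∀ ω, LZero (nab ω)),
      (∀ n, X.IsFibre (fhat n) (f n)) →
      ((∃ ghat, IsLUB (Set.range fhat) ghat) ↔
        ∀ᵐ ω ∂lam, ∃ g, IsLUB (Set.range fun n => f n ω) g) ∧
      ∀ ghat, IsLUB (Set.range fhat) ghat →
        ∀ g : ∀ ω, LZero (nab ω), X.IsFibre ghat g →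
          ∀ᵐ ω ∂lam, IsLUB (Set.range fun n => f n ω) (g ω) := by
  refine ⟨fun fhat => ?_, fun fhat f hf => ⟨BooleanBundle.exists_isLUB_iff_ae hf,
    fun ghat h g hg => BooleanBundle.ae_isLUB_of_isLUB hf h hg⟩⟩
  obtain ⟨f, hf⟩ := BooleanBundle.exists_isFibre fhat
  exact ⟨f, hf, fun f' hf' => hf.ae_eq hf'⟩
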